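/- Let $G=(V,E)$ be a finite acyclic directed network (parallel edges allowed) with unit-capacity edges, a source node, and $t$ receiver nodes, such that the min-cut value between the source and each receiver equals $n$. Let $k\le n$ and $\mu\le n-k$, and let $\mathbb{F}_q$ be a finite field with $$q>\binom{|E|-1}{\mu-1}+t,$$ where $\binom{m}{-1}=0$ (the case $\mu=0$). Then secure multicast at rate $k$ over $\mathbb{F}_q$ in the presence of a wiretapper who observes at most $\mu$ edges is possible. Precisely, there are a $k\times n$ matrix $H$ of rank $k$ over $\mathbb{F}_q$ and a linear network code over $\mathbb{F}_q$ (an edge leaving the source carries a linear combination of the $n$ symbols $Y$ injected at the source, and any other edge carries a linear combination of the symbols on the edges entering its tail) with the following property. Let the source encode the information symbols $S\in\mathbb{F}_q^k$ into $Y\in\mathbb{F}_q^n$ drawn uniformly from the coset $\{y : Hy=S\}$. Then every receiver can recover $Y$, and hence $S=HY$, from the symbols on its incoming edges; and for every probability distribution of $S$ and every set $W\subseteq E$ with $|W|\le\mu$, the symbols $Z_W$ carried by the edges of $W$ satisfy $H(S\mid Z_W)=H(S)$, where $H(\cdot)$ and $H(\cdot\mid\cdot)$ denote Shannon entropy and conditional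 entropy. -/

import Mathlib

open scoped Matrix

namespace Wiretap

/-- A network with unit-capacity edges and a distinguished source: a directed multigraph
(parallel edges allowed) in which each edge `e` goes from `tail e` to `head e`. -/
structure Network (V E : Type*) where
  tail : E → V
  head : E → V
  source : V

namespace Network

variable {V E : Type*}

/-- There is an edge from `u` to `v`. -/
def Step (N : Network V E) (u v : V) : Prop :=
  ∃ e, N.tail e = u ∧ N.head e = v

/-- There is no directed cycle. -/
def Acyclic (N : Network V E) : Prop :=
  ∀ v, ¬ Relation.TransGen N.Step v v

/-- The edges that leave the vertex set `A`. -/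
def cutEdges (N : Network V E) (A : Set V) : Set E :=
  {e | N.tail e ∈ A ∧ N.head e ∉ A}

/-- The min-cut value between the source and `r` is `n`. No `n` qualifies if `r` is the source. -/
def HasMinCut (N : Network V E) (r : V) (n : ℕ) : Prop :=
  IsLeast {c : ℕ | ∃ A : Set V, N.source ∈ A ∧ r ∉ A ∧ c = (N.cutEdges A).ncard} n

end Network

/-- A linear network code over `F` for a source that injects `n` symbols `y : Fin n → F`.
The edge `e` carries the inner product of its (global) coding vector with `y`. At the source the
coding vectors are free; at every other node `v` the packet on an outgoing edge is
a linear combination, with the coefficients `coeff`, of the packets on the edges into `v`. -/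
structure LinearNetworkCode {V E : Type*} [Fintype E] [DecidableEq V] (N : Network V E)
    (F : Type*) [Field F] (n : ℕ) where
  codingVector : E → Fin n → F
  coeff : E → E → F
  codingVector_eq : ∀ e, N.tail e ≠ N.source →
    codingVector e = ∑ e' with N.head e' = N.tail e, coeff e e' • codingVector e'

namespace LinearNetworkCode

variable {V E : Type*} [Fintype E] [DecidableEq V] {N : Network V E}
  {F : Type*} [Field F] {n : ℕ}

/-- The packet on the edge `e` when the source injects `y`. -/
def packet (c : LinearNetworkCode N F n) (y : Fin n → F) (e : E) : F :=
  c.codingVector e ⬝ᵥ y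

/-- The packets on the edges into the node `v`. -/
def received (c : LinearNetworkCode N F n) (v : V) (y : Fin n → F) :
    {e : E // N.head e = v} → F :=
  fun e => c.packet y e

/-- The packets on the edges of `W`, that is `C_W y`. -/
def observed (c : LinearNetworkCode N F n) (W : Finset E) (y : Fin n → F) : W → F :=
  fun e => c.packet y e

end LinearNetworkCode

/-- A linear wiretap (coset) code with `k` information symbols and length `n`, given by
a `k × n` parity check matrix `H` of full row rank. -/
structure CosetCode (F : Type*) [Field F] (k n : ℕ) where
  H : Matrix (Fin k) (Fin n) F
  rank_eq : H.rank = k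

namespace CosetCode

variable {F : Type*} [Field F] {k n : ℕ}

/-- The coset of words with syndrome `s`. -/
def coset [Fintype F] [DecidableEq F] (C : CosetCode F k n) (s : Fin k → F) :
    Finset (Fin n → F) :=
  {y | C.H *ᵥ y = s}

theorem coset_nonempty [Fintype F] [DecidableEq F] (C : CosetCode F k n) (s : Fin k → F) :
    (C.coset s).Nonempty := by
  have h : LinearMap.range C.H.mulVecLin = ⊤ := by
    apply Submodule.eq_top_of_finrank_eq
    have := C.rank_eq
    rw [Matrix.rank] at this
    simpa using this
  obtain ⟨y, hy⟩ := LinearMap.range_eq_top.mp h s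
  exact ⟨y, by simpa [coset] using hy⟩

/-- The probabilistic encoder: given the information symbols `s`, the word `y` is uniform on
the coset with syndrome `s`. -/
noncomputable def encode [Fintype F] [DecidableEq F] (C : CosetCode F k n) (s : Fin k → F) :
    PMF (Fin n → F) :=
  PMF.uniformOfFinset (C.coset s) (C.coset_nonempty s)

end CosetCode

/-- The Shannon entropy of a distribution on a finite type (in nats). -/
noncomputable def entropy {α : Type*} [Fintype α] (p : PMF α) : ℝ :=
  ∑ a, Real.negMulLog (p a).toReal

/-- The conditional entropy `H(A | B) = ∑ b, P(B = b) H(A | B = b)` of a pair `(A, B)` with joint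
distribution `p`. -/
noncomputable def condEntropy {α β : Type*} [Fintype α] [Fintype β] (p : PMF (α × β)) : ℝ :=
  ∑ b, ((p.map Prod.snd) b).toReal *
    ∑ a, Real.negMulLog ((p (a, b)).toReal / ((p.map Prod.snd) b).toReal)

/-- The joint distribution of `(S, Z_W)`: the information symbols `S` have distribution `p`,
they are encoded by `C`, the result `Y` is sent by `c`, and `Z_W` is what the edges of `W` carry. -/
noncomputable def jointLaw {V E : Type*} [Fintype E] [DecidableEq V] {N : Network V E}
    {F : Type*} [Field F] [Fintype F] [DecidableEq F] {k n : ℕ}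
    (C : CosetCode F k n) (c : LinearNetworkCode N F n) (p : PMF (Fin k → F)) (W : Finset E) :
    PMF ((Fin k → F) × (W → F)) :=
  p.bind fun s => (C.encode s).map fun y => (s, c.observed W y)

/-- `C` followed by `c` securely multicasts `k` symbols to the receivers `R` in the presence of
a wiretapper who observes at most `μ` edges: each receiver recovers `Y` from its incoming packets,
hence `S = H Y`, and `H(S | Z_W) = H(S)` for all distributions of `S` and all `W` with
`|W| ≤ μ`. -/
def IsSecureMulticast {V E : Type*} [Fintype E] [DecidableEq V] [DecidableEq E]
    {N : Network V E} {F : Type*} [Field F] [Fintype F] [DecidableEq F] {k n t : ℕ}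
    (C : CosetCode F k n) (c : LinearNetworkCode N F n) (R : Fin t → V) (μ : ℕ) : Prop :=
  (∀ j, ∃ D : ({e : E // N.head e = R j} → F) → (Fin n → F),
    ∀ s, ∀ y ∈ (C.encode s).support,
      D (c.received (R j) y) = y ∧ C.H *ᵥ D (c.received (R j) y) = s) ∧
  ∀ p : PMF (Fin k → F), ∀ W : Finset E, W.card ≤ μ →
    condEntropy (jointLaw C c p W) = entropy p

end Wiretap

/-! Any `H` of rank `k` will do; its row space `P` is fixed first and the network code is adapted to
it. Edges receive their vectors one at a time in topological order, unassigned edges carrying zero.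
Two invariants are kept. Decoding (`CutBound`): for every cut towards a receiver, the rank known
beyond it plus the number of its free edges is at least `n`. Secrecy (`Secure`): `P` meets the span
of any `μ` coding vectors trivially.

For the next edge, each receiver forbids one proper subspace of the available vectors, because by
submodularity the tight cuts crossed by the edge have a least member (`CutBound.exists_avoid`). Each
set `W` of `μ - 1` other edges forbids at most `P ⊔ span W` (`Secure.update`). There are fewer than
`q` such subspaces, so they do not cover the available ones.

At the end each receiver sees rank `n`. Secrecy gives, for each syndrome, a word invisible on `W`;
translating the zero coset by it shows that `Z_W` is independent of `S`. -/

namespace Wiretap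

/-! ### Avoiding subspaces. -/

section LinearAlgebra

variable {F M : Type*} [Field F] [AddCommGroup M] [Module F M]

/-- Given fewer than `|F|` subspaces, a subspace `U` has a vector that lies outside all of those
that do not contain `U`. -/
theorem exists_mem_forall_notMem [Finite F] {ι : Type*} (s : Finset ι) (U : Submodule F M)
    (p : ι → Submodule F M) (hs : s.card < Nat.card F) :
    ∃ v ∈ U, ∀ i ∈ s, ¬ U ≤ p i → v ∉ p i := by
  classical
  have h := Submodule.iUnion_ssubset_of_forall_ne_top_of_card_lt (K := F)
    (s.filter fun i => ¬ U ≤ p i).attach (fun i => (p i).comap U.subtype)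
    (fun i hi => (Finset.mem_filter.1 i.2).2 (by rwa [Submodule.comap_subtype_eq_top] at hi))
    (by
      rw [Finset.card_attach, ENat.card_eq_coe_natCard]
      exact_mod_cast (Finset.card_filter_le _ _).trans_lt hs)
  obtain ⟨v, -, hv⟩ := Set.exists_of_ssubset h
  refine ⟨v, v.2, fun i hi hU hvi => hv ?_⟩
  simp only [Set.mem_iUnion]
  exact ⟨⟨i, Finset.mem_filter.2 ⟨hi, hU⟩⟩, Finset.mem_attach _ _, hvi⟩

theorem disjoint_sup_span_singleton {P Q : Submodule F M} {v : M} (h : Disjoint P Q)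
    (hv : v ∉ P ⊔ Q) : Disjoint P (Q ⊔ F ∙ v) := by
  have hd : Disjoint (P ⊔ Q) (F ∙ v) := Submodule.disjoint_span_singleton_of_notMem hv
  exact h.disjoint_sup_right_of_disjoint_sup_left hd

end LinearAlgebra

/-! ### Cuts and the decoding invariant. -/

namespace Network

variable {V E F M : Type*} [Field F] [AddCommGroup M] [Module F M]

open Classical in
/-- The vectors that may be put on the edges out of `v`, given the coding vectors `c` of the
edges into `v`. -/
noncomputable def available (F : Type*) [Field F] [Module F M] (N : Network V E) (c : E → M)
    (v : V) : Submodule F M :=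
  if v = N.source then ⊤ else Submodule.span F (c '' {e | N.head e = v})

/-- The span of the coding vectors of the edges that end outside `A`. -/
def outerSpan (F : Type*) [Field F] [Module F M] (N : Network V E) (c : E → M) (A : Set V) :
    Submodule F M :=
  Submodule.span F (c '' {e | N.head e ∉ A})

/-- The capacity of the cut `A` when the coding vectors `c` have been assigned to the edges
of `D`: the dimension of what is already known outside `A` plus the number of edges of the
cut that are still free. -/
noncomputable def residualCut (F : Type*) [Field F] [Module F M] (N : Network V E) (c : E → M)
    (D : Set E) (A : Set V) : ℕ :=
  Module.finrank F (N.outerSpan F c A) + (N.cutEdges A \ D).ncard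

/-- Every cut between the source and `r` has residual capacity at least `n`. -/
def CutBound (F : Type*) [Field F] [Module F M] (N : Network V E) (c : E → M) (D : Set E)
    (r : V) (n : ℕ) : Prop :=
  ∀ A : Set V, N.source ∈ A → r ∉ A → n ≤ N.residualCut F c D A

theorem outerSpan_anti (N : Network V E) (c : E → M) {A B : Set V} (h : A ⊆ B) :
    N.outerSpan F c B ≤ N.outerSpan F c A :=
  Submodule.span_mono (Set.image_mono fun _ he hA => he (h hA))

theorem outerSpan_inter (N : Network V E) (c : E → M) (A B : Set V) :
    N.outerSpan F c (A ∩ B) = N.outerSpan F c A ⊔ N.outerSpan F c B := by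
  rw [outerSpan, outerSpan, outerSpan, ← Submodule.span_union, ← Set.image_union]
  congr 2
  ext e
  simp only [Set.mem_inter_iff, Set.mem_ofPred_eq, Set.mem_union]
  tauto

theorem outerSpan_diff_singleton (N : Network V E) (c : E → M) (A : Set V) (u : V) :
    N.outerSpan F c (A \ {u}) =
      N.outerSpan F c A ⊔ Submodule.span F (c '' {e | N.head e = u}) := by
  rw [outerSpan, outerSpan, ← Submodule.span_union, ← Set.image_union]
  congr 2
  ext e
  simp only [Set.mem_sdiff, Set.mem_singleton_iff, Set.mem_ofPred_eq, Set.mem_union]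
  tauto

theorem outerSpan_le_update [DecidableEq E] (N : Network V E) {c : E → M} {e : E} (he : c e = 0)
    (v : M) (A : Set V) : N.outerSpan F c A ≤ N.outerSpan F (Function.update c e v) A := by
  refine Submodule.span_le.2 ?_
  rintro _ ⟨e', he', rfl⟩
  by_cases h : e' = e
  · rw [h, he]
    exact zero_mem _
  · exact Submodule.subset_span ⟨e', he', Function.update_of_ne h _ _⟩

variable [Finite E]

theorem ncard_free_submodular (N : Network V E) (D : Set E) (A B : Set V) :
    (N.cutEdges (A ∩ B) \ D).ncard + (N.cutEdges (A ∪ B) \ D).ncard ≤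
      (N.cutEdges A \ D).ncard + (N.cutEdges B \ D).ncard := by
  rw [← Set.ncard_union_add_ncard_inter, ← Set.ncard_union_add_ncard_inter (N.cutEdges A \ D)]
  refine add_le_add (Set.ncard_le_ncard fun e => ?_) (Set.ncard_le_ncard fun e => ?_) <;>
  · simp only [cutEdges, Set.mem_union, Set.mem_inter_iff, Set.mem_sdiff, Set.mem_ofPred_eq]
    tauto

variable [FiniteDimensional F M]

theorem residualCut_submodular (N : Network V E) (c : E → M) (D : Set E) (A B : Set V) :
    N.residualCut F c D (A ∩ B) + N.residualCut F c D (A ∪ B) ≤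
      N.residualCut F c D A + N.residualCut F c D B := by
  have h₁ := Submodule.finrank_sup_add_finrank_inf_eq (N.outerSpan F c A) (N.outerSpan F c B)
  have h₂ : Module.finrank F (N.outerSpan F c (A ∪ B)) ≤
      Module.finrank F ↥(N.outerSpan F c A ⊓ N.outerSpan F c B) :=
    Submodule.finrank_mono (le_inf (N.outerSpan_anti c Set.subset_union_left)
      (N.outerSpan_anti c Set.subset_union_right))
  have h₃ := N.ncard_free_submodular D A B
  rw [← N.outerSpan_inter c A B] at h₁
  unfold residualCut
  omega

/-- For an edge `e` that can be coded next, one proper subspace of the available vectors has to be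
avoided so that the bound on the cuts between the source and `r` persists. -/
theorem CutBound.exists_avoid [Finite V] {N : Network V E} {c : E → M} {D : Set E} {r : V} {n : ℕ}
    (h : N.CutBound F c D r n) (hn : n ≤ Module.finrank F M) {e : E} (he : e ∉ D)
    (hin : ∀ e', N.head e' = N.tail e → e' ∈ D) :
    ∃ L : Submodule F M, ∀ A : Set V, N.source ∈ A → r ∉ A → e ∈ N.cutEdges A →
      N.residualCut F c D A = n → N.outerSpan F c A ≤ L ∧ ¬ N.available F c (N.tail e) ≤ L := by
  by_cases hT : ∃ A : Set V, (N.source ∈ A ∧ r ∉ A ∧ e ∈ N.cutEdges A ∧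
      N.residualCut F c D A = n)
  swap
  -- With no tight cut there is nothing to avoid, and `⊤` excludes no vector since it contains the
  -- available space.
  · exact ⟨⊤, fun A hs hr heA hA => absurd ⟨A, hs, hr, heA, hA⟩ hT⟩
  obtain ⟨A, ⟨hs, hr, heA, hA⟩, hmin⟩ := exists_minimal_of_wellFoundedLT _ hT
  refine ⟨N.outerSpan F c A, fun B hsB hrB heB hB => ⟨?_, fun hle => ?_⟩⟩
  -- Submodularity makes `A ∩ B` tight, and `e` still crosses it; minimality of `A` then gives `A ⊆
  -- B`.
  · have hAB : A ≤ A ∩ B := by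
      refine hmin ⟨⟨hs, hsB⟩, fun h' => hr h'.1, ⟨⟨heA.1, heB.1⟩, fun h' => heA.2 h'.1⟩, ?_⟩
        Set.inter_subset_left
      have h₁ := N.residualCut_submodular (F := F) c D A B
      have h₂ := h (A ∩ B) ⟨hs, hsB⟩ fun h' => hr h'.1
      have h₃ := h (A ∪ B) (Or.inl hs) fun h' => h'.elim hr hrB
      omega
    exact N.outerSpan_anti c fun v hv => (hAB hv).2
  · by_cases hu : N.tail e = N.source
    · rw [available, if_pos hu, top_le_iff] at hle
      -- The outer span is already everything, and `e` is free on top of it, so `A` is not tight.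
      have : 0 < (N.cutEdges A \ D).ncard := (Set.ncard_pos).2 ⟨e, heA, he⟩
      rw [residualCut, hle, finrank_top] at hA
      omega
    · rw [available, if_neg hu] at hle
      -- Moving `tail e` across the cut adds no rank and no free edge, as all edges into it are
      -- coded, but loses the free edge `e`. The residual would drop below `n`.
      have h₁ := h (A \ {N.tail e}) ⟨hs, fun h' => hu h'.symm⟩ fun h' => hr h'.1
      have h₂ : (N.cutEdges (A \ {N.tail e}) \ D).ncard < (N.cutEdges A \ D).ncard := by
        refine Set.ncard_lt_ncard ⟨fun e' he' => ?_, fun hsub => ?_⟩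
        · refine ⟨⟨he'.1.1.1, fun hh => ?_⟩, he'.2⟩
          by_cases heq : N.head e' = N.tail e
          · exact he'.2 (hin e' heq)
          · exact he'.1.2 ⟨hh, heq⟩
        · exact (hsub ⟨heA, he⟩).1.1.2 rfl
      rw [residualCut, outerSpan_diff_singleton, sup_eq_left.2 hle] at h₁
      rw [residualCut] at hA
      omega

/-- A cut crossed by `e` loses one free edge. Either it had slack, or it was tight and `v` raises
its outer rank by one. As `e` carried zero before, no span shrinks. -/
theorem CutBound.update [DecidableEq E] {N : Network V E} {c : E → M} {D : Set E} {r : V} {n : ℕ}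
    (h : N.CutBound F c D r n) {e : E} (he : e ∉ D) (hc : c e = 0) {v : M} {L : Submodule F M}
    (hL : ∀ A : Set V, N.source ∈ A → r ∉ A → e ∈ N.cutEdges A →
      N.residualCut F c D A = n → N.outerSpan F c A ≤ L ∧ v ∉ L) :
    N.CutBound F (Function.update c e v) (insert e D) r n := by
  intro A hs hr
  have hle := N.outerSpan_le_update (F := F) hc v A
  have hA := h A hs hr
  have hmono := Submodule.finrank_mono hle
  unfold residualCut at hA ⊢
  by_cases heA : e ∈ N.cutEdges A
  · have hcard : (N.cutEdges A \ insert e D).ncard + 1 = (N.cutEdges A \ D).ncard := by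
      rw [← Set.ncard_sdiff_singleton_add_one (show e ∈ N.cutEdges A \ D from ⟨heA, he⟩),
        Set.sdiff_sdiff, Set.union_singleton]
    by_cases hv' : v ∈ N.outerSpan F c A
    · have : N.residualCut F c D A ≠ n := fun h' => (hL A hs hr heA h').2 ((hL A hs hr heA h').1 hv')
      unfold residualCut at this
      omega
    · have hlt : N.outerSpan F c A < N.outerSpan F (Function.update c e v) A := by
        refine lt_of_le_of_ne hle fun heq => hv' ?_
        rw [heq]
        exact Submodule.subset_span ⟨e, heA.2, Function.update_self _ _ _⟩
      have := Submodule.finrank_lt_finrank_of_lt hlt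
      omega
  · have : N.cutEdges A \ insert e D = N.cutEdges A \ D := by
      ext e'
      simp only [Set.mem_sdiff, Set.mem_insert_iff]
      constructor
      · tauto
      · rintro ⟨h₁, h₂⟩
        exact ⟨h₁, fun h' => h'.elim (fun h'' => heA (h'' ▸ h₁)) h₂⟩
    rw [this]
    omega

end Network

/-! ### The secrecy invariant and the greedy construction. -/

namespace Network

variable {V E F M : Type*} [Field F] [AddCommGroup M] [Module F M]

/-- In an acyclic network, the edges outside a proper subset `D` include one whose predecessors
all belong to `D`. -/
theorem Acyclic.exists_next [Finite V] {N : Network V E} (hN : N.Acyclic) {D : Set E}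
    (hD : D ≠ Set.univ) : ∃ e ∉ D, ∀ e', N.head e' = N.tail e → e' ∈ D := by
  have : Std.Irrefl (Relation.TransGen N.Step) := ⟨hN⟩
  have hwf : WellFounded (Relation.TransGen N.Step) := Finite.wellFounded_of_trans_of_irrefl _
  have hne : (N.tail '' Dᶜ).Nonempty := (Set.nonempty_compl.2 hD).image _
  obtain ⟨e, he, hu⟩ := hwf.min_mem _ hne
  refine ⟨e, he, fun e' he' => by_contra fun h => ?_⟩
  refine hwf.not_lt_min (N.tail '' Dᶜ) ⟨e', h, rfl⟩ ?_
  rw [← hu, ← he']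
  exact .single ⟨e', rfl, rfl⟩

/-- The coding vectors `c` are admissible, and they have been assigned to the edges of `D` only,
where `D` is closed under predecessors. -/
structure IsPartialCode (F : Type*) [Field F] [Module F M] (N : Network V E) (c : E → M)
    (D : Set E) : Prop where
  closed : ∀ e ∈ D, ∀ e', N.head e' = N.tail e → e' ∈ D
  eq_zero : ∀ e ∉ D, c e = 0
  mem : ∀ e, c e ∈ N.available F c (N.tail e)

theorem available_congr (N : Network V E) {c c' : E → M} {v : V}
    (h : ∀ e, N.head e = v → c' e = c e) : N.available F c' v = N.available F c v := by
  unfold available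
  rw [Set.image_congr (show ∀ e ∈ {e | N.head e = v}, c' e = c e from h)]

/-- Edges feeding `e` or an edge of `D` lie in `D`, so the new vector on `e` does not alter what is
available there. The remaining edges carry zero. -/
theorem IsPartialCode.update [DecidableEq E] {N : Network V E} {c : E → M} {D : Set E}
    (h : N.IsPartialCode F c D) {e : E} (he : e ∉ D) (hin : ∀ e', N.head e' = N.tail e → e' ∈ D)
    {v : M} (hv : v ∈ N.available F c (N.tail e)) :
    N.IsPartialCode F (Function.update c e v) (insert e D) where
  closed e₁ he₁ e' he' := by
    rcases he₁ with rfl | he₁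
    · exact Or.inr (hin e' he')
    · exact Or.inr (h.closed e₁ he₁ e' he')
  eq_zero e₁ he₁ := by
    rw [Set.mem_insert_iff, not_or] at he₁
    rw [Function.update_of_ne he₁.1, h.eq_zero e₁ he₁.2]
  mem e₁ := by
    by_cases he₁ : e₁ ∈ insert e D
    · have hin' : ∀ e', N.head e' = N.tail e₁ → e' ∈ D := by
        rcases he₁ with rfl | he₁
        exacts [hin, h.closed e₁ he₁]
      rw [N.available_congr fun e' he' =>
        Function.update_of_ne (ne_of_mem_of_not_mem (hin' e' he') he) _ _]
      by_cases h₁ : e₁ = e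
      · rwa [h₁, Function.update_self]
      · rw [Function.update_of_ne h₁]
        exact h.mem e₁
    · rw [Set.mem_insert_iff, not_or] at he₁
      rw [Function.update_of_ne he₁.1, h.eq_zero e₁ he₁.2]
      exact zero_mem _

/-- No nonzero vector of `P` can be obtained from the coding vectors of at most `μ` edges. -/
def Secure (F : Type*) [Field F] [Module F M] (c : E → M) (P : Submodule F M) (μ : ℕ) : Prop :=
  ∀ W : Finset E, W.card ≤ μ → Disjoint P (Submodule.span F (c '' W))

/-- This settles the sets `W` that exclude no vector. At the source the inclusion fails by
dimension. Elsewhere, write an incoming vector as `p + w`; then `p` lies in `P` and in the span of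
at most `μ` coding vectors, hence vanishes. -/
theorem Secure.available_le [DecidableEq E] [FiniteDimensional F M] {N : Network V E} {c : E → M}
    {P : Submodule F M}
    {μ : ℕ} (h : Secure F c P μ) (hP : Module.finrank F P + μ ≤ Module.finrank F M)
    {W : Finset E} (hW : W.card + 1 ≤ μ) {u : V}
    (hle : N.available F c u ≤ P ⊔ Submodule.span F (c '' W)) :
    N.available F c u ≤ Submodule.span F (c '' W) := by
  unfold available at hle ⊢
  split_ifs at hle ⊢ with hu
  · exfalso
    have h₁ := Submodule.finrank_mono hle
    have h₂ := Submodule.finrank_add_le_finrank_add_finrank P (Submodule.span F (c '' W))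
    have h₃ : Module.finrank F (Submodule.span F (c '' W)) ≤ W.card := by
      classical
      rw [← Finset.coe_image]
      exact (finrank_span_finset_le_card _).trans Finset.card_image_le
    rw [finrank_top] at h₁
    omega
  · refine Submodule.span_le.2 ?_
    rintro _ ⟨e, he, rfl⟩
    obtain ⟨p, hp, w, hw, hpw⟩ := Submodule.mem_sup.1 (hle (Submodule.subset_span ⟨e, he, rfl⟩))
    have hd := h (insert e W) ((Finset.card_insert_le _ _).trans hW)
    have hp0 : p = 0 := by
      refine Submodule.disjoint_def.1 hd p hp ?_
      rw [eq_sub_of_add_eq hpw]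
      refine sub_mem (Submodule.subset_span ⟨e, by simp, rfl⟩) (Submodule.span_mono ?_ hw)
      exact Set.image_mono (by simp)
    rw [hp0, zero_add] at hpw
    rw [← hpw]
    exact hw

theorem Secure.update [DecidableEq E] [FiniteDimensional F M] [Fintype E] {N : Network V E}
    {c : E → M} {P : Submodule F M}
    {μ : ℕ} (h : Secure F c P μ) (hP : Module.finrank F P + μ ≤ Module.finrank F M)
    (hμ : μ ≤ Fintype.card E) {e : E} {v : M} (hv : v ∈ N.available F c (N.tail e))
    (havoid : ∀ W ⊆ Finset.univ.erase e, W.card + 1 = μ →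
      ¬ N.available F c (N.tail e) ≤ P ⊔ Submodule.span F (c '' W) →
      v ∉ P ⊔ Submodule.span F (c '' W)) :
    Secure F (Function.update c e v) P μ := by
  have hupd : ∀ W : Finset E, e ∉ W → Function.update c e v '' W = c '' W := fun W heW =>
    Set.image_congr fun e' he' => Function.update_of_ne (ne_of_mem_of_not_mem he' heW) _ _
  intro W hW
  by_cases heW : e ∈ W
  swap
  · rw [hupd W heW]
    exact h W hW
  have hcard := Finset.card_erase_add_one heW
  -- Enlarging to exactly `μ - 1` edges other than `e` leaves only `(|E| - 1).choose (μ - 1)`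
  -- conditions; this needs `μ ≤ |E|`.
  obtain ⟨W', hWW', hW'u, hW'⟩ := Finset.exists_subsuperset_card_eq (n := μ - 1)
    (Finset.erase_subset_erase e (Finset.subset_univ W)) (by omega)
    (by rw [Finset.card_erase_of_mem (Finset.mem_univ e), Finset.card_univ]; omega)
  have heW' : e ∉ W' := fun h' => Finset.notMem_erase e _ (hW'u h')
  have hd : Disjoint P (Submodule.span F (c '' W') ⊔ F ∙ v) := by
    have hd' := h W' (by omega)
    by_cases hle : N.available F c (N.tail e) ≤ P ⊔ Submodule.span F (c '' W')
    · have hvW := h.available_le hP (by omega) hle hv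
      rwa [sup_eq_left.2 (by simpa using hvW)]
    · exact disjoint_sup_span_singleton hd' (havoid W' hW'u (by omega) hle)
  refine hd.mono_right (Submodule.span_le.2 ?_)
  rintro _ ⟨e', he', rfl⟩
  by_cases h' : e' = e
  · rw [h', Function.update_self]
    exact Submodule.mem_sup_right (Submodule.mem_span_singleton_self v)
  · rw [Function.update_of_ne h']
    exact Submodule.mem_sup_left (Submodule.subset_span
      ⟨e', hWW' (Finset.mem_erase.2 ⟨h', he'⟩), rfl⟩)

theorem IsPartialCode.exists_extension [Finite V] [Fintype E] [DecidableEq E] [Finite F]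
    [FiniteDimensional F M] {N : Network V E} {c : E → M} {D : Set E} {n t μ : ℕ} {R : Fin t → V}
    {P : Submodule F M} (h : N.IsPartialCode F c D) (hcut : ∀ j, N.CutBound F c D (R j) n)
    (hsec : Secure F c P μ) (hn : n ≤ Module.finrank F M)
    (hP : Module.finrank F P + μ ≤ Module.finrank F M) (hμ : μ ≤ Fintype.card E)
    (hF : (if μ = 0 then 0 else (Fintype.card E - 1).choose (μ - 1)) + t < Nat.card F)
    {e : E} (he : e ∉ D) (hin : ∀ e', N.head e' = N.tail e → e' ∈ D) :
    ∃ c' : E → M, N.IsPartialCode F c' (insert e D) ∧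
      (∀ j, N.CutBound F c' (insert e D) (R j) n) ∧ Secure F c' P μ := by
  choose L hL using fun j => (hcut j).exists_avoid hn he hin
  -- For `μ = 0` truncated subtraction would leave the empty set as a spurious condition.
  let T : Finset (Finset E) := if μ = 0 then ∅ else (Finset.univ.erase e).powersetCard (μ - 1)
  have hT : T.card = if μ = 0 then 0 else (Fintype.card E - 1).choose (μ - 1) := by
    by_cases h0 : μ = 0
    · simp [T, h0]
    · simp [T, h0, Finset.card_powersetCard, Finset.card_erase_of_mem]
  obtain ⟨v, hv, hav⟩ := exists_mem_forall_notMem (F := F) (T.disjSum (Finset.univ : Finset (Fin t)))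
    (N.available F c (N.tail e)) (Sum.elim (fun W => P ⊔ Submodule.span F (c '' W)) L)
    (by rwa [Finset.card_disjSum, hT, Finset.card_univ, Fintype.card_fin])
  refine ⟨Function.update c e v, h.update he hin hv, fun j => ?_, ?_⟩
  · refine (hcut j).update he (h.eq_zero e he) (L := L j) fun A hs hr heA hA => ?_
    obtain ⟨h₁, h₂⟩ := hL j A hs hr heA hA
    exact ⟨h₁, hav (Sum.inr j) (by simp) h₂⟩
  · refine hsec.update hP hμ hv fun W hW hcard => hav (Sum.inl W) ?_
    rw [Finset.inl_mem_disjSum]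
    have h0 : μ ≠ 0 := by omega
    simp only [T, if_neg h0, Finset.mem_powersetCard]
    exact ⟨hW, by omega⟩

/-- Admissible coding vectors that keep all cuts towards the receivers at rank `n` and reveal
nothing of `P` to `μ` edges. -/
theorem exists_code [Finite V] [Fintype E] [DecidableEq E] [Finite F] [FiniteDimensional F M]
    {N : Network V E} (hN : N.Acyclic) {n t μ : ℕ} {R : Fin t → V}
    (hR : ∀ j, ∀ A : Set V, N.source ∈ A → R j ∉ A → n ≤ (N.cutEdges A).ncard)
    {P : Submodule F M} (hn : n ≤ Module.finrank F M)
    (hP : Module.finrank F P + μ ≤ Module.finrank F M) (hμ : μ ≤ Fintype.card E)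
    (hF : (if μ = 0 then 0 else (Fintype.card E - 1).choose (μ - 1)) + t < Nat.card F) :
    ∃ c : E → M, (∀ e, c e ∈ N.available F c (N.tail e)) ∧
      (∀ j, N.CutBound F c Set.univ (R j) n) ∧ Secure F c P μ := by
  have key : ∀ m ≤ Fintype.card E, ∃ (D : Set E) (c : E → M), D.ncard = m ∧
      N.IsPartialCode F c D ∧ (∀ j, N.CutBound F c D (R j) n) ∧ Secure F c P μ := by
    intro m hm
    induction m with
    | zero =>
      refine ⟨∅, 0, by simp, ⟨by simp, by simp, fun e => zero_mem _⟩, fun j A hs hr => ?_, ?_⟩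
      · rw [residualCut, Set.sdiff_empty]
        exact (hR j A hs hr).trans (Nat.le_add_left _ _)
      · intro W _
        refine disjoint_bot_right.mono_right (Submodule.span_le.2 ?_)
        rintro _ ⟨e, -, rfl⟩
        simp
    | succ m ih =>
      obtain ⟨D, c, hD, hc, hcut, hsec⟩ := ih (by omega)
      obtain ⟨e, he, hin⟩ := hN.exists_next (D := D) (by
        rintro rfl
        rw [Set.ncard_univ, Nat.card_eq_fintype_card] at hD
        omega)
      obtain ⟨c', h'⟩ := hc.exists_extension hcut hsec hn hP hμ hF he hin
      exact ⟨insert e D, c', by rw [Set.ncard_insert_of_notMem he, hD], h'⟩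
  obtain ⟨D, c, hD, hc, hcut, hsec⟩ := key _ le_rfl
  obtain rfl : D = Set.univ := by
    refine Set.eq_of_subset_of_ncard_le (Set.subset_univ _) ?_
    rw [Set.ncard_univ, Nat.card_eq_fintype_card, hD]
  exact ⟨c, hc.mem, hcut, hsec⟩

end Network
-- Entropy under independence.
/-- Independence of `B` from `A` leaves the entropy of `A` unchanged. -/
theorem condEntropy_of_indep {α β : Type*} [Fintype α] [Fintype β] (p : PMF α) (q : PMF β) :
    condEntropy (p.bind fun a => q.map (Prod.mk a)) = entropy p := by
  classical
  have hjoint : ∀ a b, (p.bind fun a => q.map (Prod.mk a)) (a, b) = p a * q b := by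
    intro a b
    rw [PMF.bind_apply, tsum_eq_single a]
    · rw [PMF.map_apply, tsum_eq_single b]
      · simp
      · intro b' hb
        simp [hb.symm]
    · intro a' ha
      rw [PMF.map_apply]
      simp [ha.symm]
  have hsnd : (p.bind fun a => q.map (Prod.mk a)).map Prod.snd = q := by
    rw [PMF.map_bind]
    simp only [PMF.map_comp]
    exact (PMF.bind_const p _).trans (PMF.map_id q)
  have hsum : ∑ b, (q b).toReal = 1 := by
    rw [← ENNReal.toReal_sum fun b _ => q.apply_ne_top b, ← tsum_fintype (L := .unconditional β),
      q.tsum_coe, ENNReal.toReal_one]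
  unfold condEntropy
  simp only [hsnd, hjoint, ENNReal.toReal_mul]
  rw [← one_mul (entropy p), ← hsum, Finset.sum_mul]
  refine Finset.sum_congr rfl fun b _ => ?_
  -- Values of probability zero have weight zero, so the division by zero there is harmless.
  by_cases hb : (q b).toReal = 0
  · rw [hb, zero_mul, zero_mul]
  · simp only [mul_div_cancel_right₀ _ hb, entropy]

/-! ### Coset codes. -/

namespace CosetCode

variable {F : Type*} [Field F] {k n : ℕ}

/-- The first `k` symbols as syndrome. -/
def systematic (F : Type*) [Field F] {k n : ℕ} (hk : k ≤ n) : CosetCode F k n where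
  H := (1 : Matrix (Fin n) (Fin n) F).submatrix (Fin.castLE hk) id
  rank_eq := by
    have h : LinearIndependent F
        ((1 : Matrix (Fin n) (Fin n) F).submatrix (Fin.castLE hk) id).row :=
      (Matrix.linearIndependent_rows_of_isUnit isUnit_one).comp _ (Fin.castLE_injective hk)
    rw [h.rank_matrix, Fintype.card_fin]

/-- The row space of the parity check matrix. -/
def rowSpace (C : CosetCode F k n) : Submodule F (Fin n → F) :=
  Submodule.span F (Set.range C.H.row)

theorem finrank_rowSpace (C : CosetCode F k n) : Module.finrank F C.rowSpace = k := by
  rw [rowSpace, ← Matrix.rank_eq_finrank_span_row, C.rank_eq]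

theorem vecMul_injective (C : CosetCode F k n) : Function.Injective C.H.vecMul := by
  rw [Matrix.vecMul_injective_iff, linearIndependent_iff_card_eq_finrank_span, Fintype.card_fin]
  exact C.finrank_rowSpace.symm

/-- If the row space meets the span of the vectors `c` trivially, every syndrome is attained by
a word orthogonal to all `c`. -/
theorem exists_orthogonal {ι : Type*} [Finite ι] (C : CosetCode F k n) (c : ι → Fin n → F)
    (hd : Disjoint C.rowSpace (Submodule.span F (Set.range c))) (s : Fin k → F) :
    ∃ y, C.H *ᵥ y = s ∧ ∀ i, c i ⬝ᵥ y = 0 := by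
  let K : Submodule F (Fin n → F) := ⨅ i, LinearMap.ker (dotProductEquiv F (Fin n) (c i))
  suffices hK : K.map C.H.mulVecLin = ⊤ by
    obtain ⟨y, hy, rfl⟩ := (hK ▸ Submodule.mem_top : s ∈ K.map C.H.mulVecLin)
    exact ⟨y, rfl, fun i => (Submodule.mem_iInf _).1 hy i⟩
  -- Otherwise some nonzero functional `a` kills the image of `K`, so `a ᵥ* H` vanishes on `K` and
  -- lies in the span of the `c i`. It is also in the row space, hence zero, and independence of the
  -- rows gives `a = 0`.
  by_contra hK
  obtain ⟨f, hf0, hf⟩ := Submodule.exists_le_ker_of_lt_top _ (lt_top_iff_ne_top.2 hK)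
  obtain ⟨a, rfl⟩ := (dotProductEquiv F (Fin k)).surjective f
  have hcomp : dotProductEquiv F (Fin k) a ∘ₗ C.H.mulVecLin =
      dotProductEquiv F (Fin n) (a ᵥ* C.H) := by
    refine LinearMap.ext fun y => ?_
    simp [Matrix.dotProduct_mulVec]
  have hmem : dotProductEquiv F (Fin n) (a ᵥ* C.H) ∈
      Submodule.span F (Set.range fun i => dotProductEquiv F (Fin n) (c i)) := by
    refine mem_span_of_iInf_ker_le_ker fun y hy => ?_
    rw [← hcomp]
    exact hf ⟨y, hy, rfl⟩
  have hrange : (Set.range fun i => dotProductEquiv F (Fin n) (c i)) =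
      (dotProductEquiv F (Fin n)).toLinearMap '' Set.range c := by
    rw [← Set.range_comp]
    rfl
  rw [hrange, Submodule.span_image] at hmem
  obtain ⟨w, hw, hwa⟩ := hmem
  obtain rfl : w = a ᵥ* C.H := (dotProductEquiv F (Fin n)).injective hwa
  have hrow : a ᵥ* C.H ∈ C.rowSpace := by
    rw [Matrix.vecMul_eq_sum]
    exact sum_mem fun i _ => Submodule.smul_mem _ _ (Submodule.subset_span ⟨i, rfl⟩)
  have h0 : a ᵥ* C.H = 0 ᵥ* C.H := by
    rw [Matrix.zero_vecMul]
    exact Submodule.disjoint_def.1 hd _ hrow hw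
  exact hf0 (by rw [C.vecMul_injective h0, map_zero])

variable [Fintype F] [DecidableEq F]

theorem encode_apply (C : CosetCode F k n) (s : Fin k → F) (y : Fin n → F) :
    C.encode s y = if C.H *ᵥ y = s then ((C.coset s).card : ENNReal)⁻¹ else 0 := by
  simp [encode, PMF.uniformOfFinset_apply, coset]

theorem encode_eq_map_add (C : CosetCode F k n) {s : Fin k → F} {x : Fin n → F}
    (hx : C.H *ᵥ x = s) : C.encode s = (C.encode 0).map (· + x) := by
  have hcard : (C.coset s).card = (C.coset 0).card := by
    refine Finset.card_bij' (fun y _ => y - x) (fun y _ => y + x) ?_ ?_ ?_ ?_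
    · intro y hy
      simpa [coset, Matrix.mulVec_sub, hx, sub_eq_zero] using hy
    · intro y hy
      simpa [coset, Matrix.mulVec_add, hx] using hy
    · simp
    · simp
  ext y
  rw [PMF.map_apply, tsum_eq_single (y - x)]
  · simp only [sub_add_cancel, if_true, encode_apply, Matrix.mulVec_sub, hx, sub_eq_zero, hcard]
  · intro y' hy'
    rw [if_neg]
    rintro rfl
    exact hy' (by simp)

end CosetCode

/-! ### From the invariants to decoding and secrecy. -/

theorem Network.CutBound.span_eq_top {V E F : Type*} [Field F] {N : Network V E} {n : ℕ}
    {c : E → Fin n → F} {r : V} (hr : r ≠ N.source)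
    (h : N.CutBound F c Set.univ r n) : Submodule.span F (c '' {e | N.head e = r}) = ⊤ := by
  -- Beyond this cut lies only `r`, and no edge is free any more, so the bound is on the rank of the
  -- edges into `r`.
  have hA := h {r}ᶜ (by simpa using hr.symm) (by simp)
  have hout : N.outerSpan F c {r}ᶜ = Submodule.span F (c '' {e | N.head e = r}) := by
    simp [Network.outerSpan]
  rw [Network.residualCut, hout] at hA
  simp only [Set.sdiff_univ, Set.ncard_empty, add_zero] at hA
  exact Submodule.eq_top_of_finrank_eq (le_antisymm (Submodule.finrank_le _) (by simpa using hA))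

section

variable {V E F : Type*} [Fintype E] [DecidableEq V] {N : Network V E} [Field F] {n : ℕ}

/-- The symbols observed on `W` are independent of the information symbols, if the coding vectors
of `W` span nothing of the row space of the parity check matrix. -/
theorem condEntropy_jointLaw [DecidableEq E] [Fintype F] [DecidableEq F] {k : ℕ} (C : CosetCode F k n)
    (c : LinearNetworkCode N F n) {W : Finset E}
    (hd : Disjoint C.rowSpace (Submodule.span F (c.codingVector '' W))) (p : PMF (Fin k → F)) :
    condEntropy (jointLaw C c p W) = entropy p := by
  have hobs : ∀ s, (C.encode s).map (c.observed W) = (C.encode 0).map (c.observed W) := by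
    intro s
    -- Translation by `x` carries the zero coset to that of `s` and leaves every observed packet
    -- unchanged.
    obtain ⟨x, hx, hx0⟩ := C.exists_orthogonal (fun e : W => c.codingVector e)
      (by rwa [Set.image_eq_range] at hd) s
    rw [C.encode_eq_map_add hx, PMF.map_comp]
    congr 1
    ext y e
    simp [LinearNetworkCode.observed, LinearNetworkCode.packet, dotProduct_add, hx0 e]
  have hlaw : jointLaw C c p W =
      p.bind fun s => ((C.encode 0).map (c.observed W)).map (Prod.mk s) := by
    unfold jointLaw
    congr 1
    ext1 s
    rw [← hobs s, PMF.map_comp]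
    rfl
  rw [hlaw, condEntropy_of_indep]

theorem LinearNetworkCode.received_injective (c : LinearNetworkCode N F n) {r : V}
    (h : Submodule.span F (c.codingVector '' {e | N.head e = r}) = ⊤) :
    Function.Injective (c.received r) := by
  intro y y' hy
  refine (dotProductEquiv F (Fin n)).injective (LinearMap.ext_on h ?_)
  rintro _ ⟨e, he, rfl⟩
  have := congrFun hy ⟨e, he⟩
  simpa [LinearNetworkCode.received, LinearNetworkCode.packet, dotProduct_comm] using this

/-- Admissible coding vectors are those of a linear network code. -/
theorem exists_linearNetworkCode {c : E → Fin n → F}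
    (h : ∀ e, c e ∈ N.available F c (N.tail e)) :
    ∃ c' : LinearNetworkCode N F n, c'.codingVector = c := by
  have hcoeff : ∀ e, ∃ a : E → F, N.tail e ≠ N.source →
      c e = ∑ e' with N.head e' = N.tail e, a e' • c e' := by
    intro e
    by_cases hs : N.tail e = N.source
    · exact ⟨0, fun h' => absurd hs h'⟩
    · have he := h e
      rw [Network.available, if_neg hs] at he
      obtain ⟨a, hsupp, ha⟩ := (Finsupp.mem_span_image_iff_linearCombination F).1 he
      refine ⟨a, fun _ => ?_⟩
      rw [← ha, Finsupp.linearCombination_apply]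
      refine Finsupp.sum_of_support_subset _ (fun e' he' => ?_) _ fun _ _ => zero_smul _ _
      simpa using hsupp he'
  choose a ha using hcoeff
  exact ⟨⟨c, a, ha⟩, rfl⟩

end

end Wiretap

/-- The field size bound is `q > C(|E| - 1, μ - 1) + t`, where `C(m, -1) = 0`. -/
theorem theorem2 {V E : Type*} [Finite V] [DecidableEq V] [Fintype E] [DecidableEq E]
    (N : Wiretap.Network V E) (hN : N.Acyclic)
    (n t : ℕ) (R : Fin t → V) (hR : ∀ j, N.HasMinCut (R j) n)
    (k μ : ℕ) (hk : k ≤ n) (hμ : μ ≤ n - k)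
    (F : Type*) [Field F] [Fintype F] [DecidableEq F]
    (hF : (if μ = 0 then 0 else (Fintype.card E - 1).choose (μ - 1)) + t < Fintype.card F) :
    ∃ (C : Wiretap.CosetCode F k n) (c : Wiretap.LinearNetworkCode N F n),
      Wiretap.IsSecureMulticast C c R μ := by
  have hcut : ∀ j, ∀ A : Set V, N.source ∈ A → R j ∉ A → n ≤ (N.cutEdges A).ncard :=
    fun j A hs hr => (hR j).2 ⟨A, hs, hr, rfl⟩
  let C := Wiretap.CosetCode.systematic F hk
  obtain ⟨c₀, hmem, hc, hsec⟩ : ∃ c : E → Fin n → F,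
      (∀ e, c e ∈ N.available F c (N.tail e)) ∧ (∀ j, N.CutBound F c Set.univ (R j) n) ∧
        Wiretap.Network.Secure F c C.rowSpace μ := by
    by_cases hμE : μ ≤ Fintype.card E
    · refine Wiretap.Network.exists_code hN hcut (by simp) ?_ hμE
        (by rwa [Nat.card_eq_fintype_card])
      rw [C.finrank_rowSpace, Module.finrank_fin_fun]
      omega
    · -- There is no receiver, since the network has fewer than `n` edges.
      refine ⟨0, fun e => zero_mem _, fun j => absurd ?_ hμE, fun W _ => ?_⟩
      · obtain ⟨A, -, -, hA⟩ := (hR j).1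
        have := Set.ncard_le_card (N.cutEdges A)
        rw [Nat.card_eq_fintype_card] at this
        omega
      · refine disjoint_bot_right.mono_right (Submodule.span_le.2 ?_)
        rintro _ ⟨e, -, rfl⟩
        simp
  obtain ⟨c, rfl⟩ := Wiretap.exists_linearNetworkCode hmem
  refine ⟨C, c, fun j => ?_, fun p W hW => Wiretap.condEntropy_jointLaw C c (hsec W hW) p⟩
  have hne : R j ≠ N.source := by
    rintro h
    obtain ⟨A, hs, hr, -⟩ := (hR j).1
    exact hr (h ▸ hs)
  obtain ⟨D, hD⟩ := (c.received_injective ((hc j).span_eq_top hne)).hasLeftInverse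
  refine ⟨D, fun s y hy => ⟨hD y, ?_⟩⟩
  rw [hD y]
  simpa [Wiretap.CosetCode.encode, Wiretap.CosetCode.coset] using hy
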